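/- Let $\alpha\in\mathbb R$ be badly approximable, i.e. $\inf_{q\in\mathbb Z\setminus\{0\}}|q|\operatorname{dist}(\alpha q,\mathbb Z)>0$, put $\lambda=\frac{\sqrt5+3}{2}$, and let $Y\subset M_{2,2}(\mathbb R)$ be the affine subspace of real $2\times2$ matrices whose top-left entry equals $\alpha$. For $f:\mathbb R_{>0}\to\mathbb R_{>0}$, a matrix $A\in M_{2,2}(\mathbb R)$ is called $f$-uniform if for every sufficiently large $t>0$ there are $\mathbf q\in\mathbb Z^2\setminus\{0\}$ and $\mathbf p\in\mathbb Z^2$ with $\|A\mathbf q-\mathbf p\|\le f(t)$ and $\|\mathbf q\|\le t$ (sup norms). Let $\hat\omega(A)\in[0,\infty]$ be the supremum of all $a>0$ such that $A$ is $\phi_a$-uniform, where $\phi_a(t)=t^{-a}$. Call $A$ totally irrational if it is not contained in any proper rational affine subspace of $M_{2,2}(\mathbb R)$, that is, one defined by affine-linear equations in the entries with rational coefficients and constants. Then: 1. $\hat\omega(A)\le\lambda$ for every totally irrational $A\in Y$; 2. if $f:\mathbb R_{>0}\to\mathbb R_{>0}$ satisfies $f(t)=O(t^{-(\lambda+\varepsilon)})$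 as $t\to\infty$ for some $\varepsilon>0$ (in particular, if $f$ decays faster than $\phi_{\lambda+\varepsilon}$ for some $\varepsilon>0$), then no totally irrational $A\in Y$ is $f$-uniform. -/

import Mathlib

/-- `A` is uniformly `f`-approximable (`f`-uniform): for every sufficiently large `t` there are
`q ∈ ℤⁿ ∖ {0}` and `p ∈ ℤᵐ` with `‖A q - p‖ ≤ f t` and `‖q‖ ≤ t`. All norms are sup norms. -/
def IsUniformlyApproximable {m n : ℕ} (f : ℝ → ℝ) (A : Matrix (Fin m) (Fin n) ℝ) : Prop :=
  ∀ᶠ t : ℝ in Filter.atTop, ∃ q : Fin n → ℤ, q ≠ 0 ∧ ∃ p : Fin m → ℤ,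
    ‖A.mulVec (fun j => (q j : ℝ)) - (fun i => (p i : ℝ))‖ ≤ f t ∧ ‖q‖ ≤ t

/-- The power function `t ↦ t ^ (-a)`. -/
noncomputable def powerDecay (a : ℝ) : ℝ → ℝ := fun t => t ^ (-a)

/-- The uniform Diophantine exponent: the supremum, in the extended reals, of all `a > 0` such
that `A` is uniformly `t ^ (-a)`-approximable. -/
noncomputable def uniformExponent {m n : ℕ} (A : Matrix (Fin m) (Fin n) ℝ) : EReal :=
  sSup ((fun a : ℝ => (a : EReal)) '' {a : ℝ | 0 < a ∧ IsUniformlyApproximable (powerDecay a) A})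

/-- A rational affine subspace of the space of real `m × n` matrices: the solution set of a system
of affine-linear equations in the entries, all of whose coefficients and constants are rational. -/
def IsRationalAffineSubspace {m n : ℕ} (S : Set (Matrix (Fin m) (Fin n) ℝ)) : Prop :=
  ∃ E : Set (Matrix (Fin m) (Fin n) ℚ × ℚ),
    S = {X | ∀ e ∈ E, ∑ i, ∑ j, (e.1 i j : ℝ) * X i j = (e.2 : ℝ)}

/-- `A` is totally irrational: it lies in no proper rational affine subspace. -/
def IsTotallyIrrational {m n : ℕ} (A : Matrix (Fin m) (Fin n) ℝ) : Prop :=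
  ∀ S : Set (Matrix (Fin m) (Fin n) ℝ), IsRationalAffineSubspace S → S ≠ Set.univ → A ∉ S

/-- `α` is badly approximable: `inf_{q ∈ ℤ ∖ {0}} |q| dist(α q, ℤ) > 0`. -/
def IsBadlyApproximable (α : ℝ) : Prop :=
  0 < ⨅ q : {q : ℤ // q ≠ 0},
    |((q : ℤ) : ℝ)| * Metric.infDist (α * ((q : ℤ) : ℝ)) (Set.range (fun k : ℤ => (k : ℝ)))

/-- The affine subspace of real `2 × 2` matrices whose top-left entry is `α`. -/
def topLeftSubspace (α : ℝ) : Set (Matrix (Fin 2) (Fin 2) ℝ) := {A | A 0 0 = α}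

/-! Only the first row `(α, β)` matters. Suppose `αx + βy - z` is uniformly small to order `ω > λ`,
and take its minimal points `P_k`, of sizes `X_k`, with value at `P_k` at most `≪ X_{k+1}^(-ω)`.
Eliminating `β` from `P_k` and `P_{k+1}` gives integers `u_k`, `v_k` with `|u_k| ≪ X_k X_{k+1}` and
`|α u_k - v_k| ≪ X_{k+1}^(1-ω)`, so bad approximability forces `X_{k+1}^(ω-2) ≪ X_k`
(`size_le_of_badlyApproximable`). If three consecutive points are independent, their nonzero integer
determinant forces `X_{k+1}^(ω-1) ≪ X_{k+2}` (`abs_det_three_le`). Together with the previous bound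
for the next pair, this contradicts `(ω-1)(ω-2) > 1` once `X_{k+1}` is large; `λ` is the larger root
of `(ω-1)(ω-2) = 1`. Hence the points eventually lie in one plane, the vectors `(u_k, v_k)` are all
parallel, and `α u_k - v_k` cannot tend to zero (`not_tendsto_zero_of_parallel`). -/

theorem IsBadlyApproximable.exists_pos_le {α : ℝ} (h : IsBadlyApproximable α) :
    ∃ c : ℝ, 0 < c ∧ ∀ q p : ℤ, q ≠ 0 → c ≤ |(q : ℝ)| * |α * q - p| := by
  refine ⟨_, h, fun q p hq => ?_⟩
  have hbdd : BddBelow (Set.range fun q : {q : ℤ // q ≠ 0} => |((q : ℤ) : ℝ)| *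
      Metric.infDist (α * ((q : ℤ) : ℝ)) (Set.range (fun k : ℤ => (k : ℝ)))) :=
    ⟨0, by rintro _ ⟨q, rfl⟩; exact mul_nonneg (abs_nonneg _) Metric.infDist_nonneg⟩
  refine (ciInf_le hbdd ⟨q, hq⟩).trans ?_
  refine mul_le_mul_of_nonneg_left ?_ (abs_nonneg _)
  exact Metric.infDist_le_dist_of_mem (Set.mem_range_self p)

/-- The entries in a row of a totally irrational matrix are linearly independent from `1`. -/
theorem IsTotallyIrrational.row_ne_zero {A : Matrix (Fin 2) (Fin 2) ℝ}
    (hA : IsTotallyIrrational A) (a b p : ℤ) (hab : a ≠ 0 ∨ b ≠ 0) :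
    A 0 0 * a + A 0 1 * b - p ≠ 0 := by
  intro h
  let e : Matrix (Fin 2) (Fin 2) ℚ × ℚ := (!![(a : ℚ), (b : ℚ); 0, 0], (p : ℚ))
  refine hA {X | ∀ e' ∈ ({e} : Set (Matrix (Fin 2) (Fin 2) ℚ × ℚ)),
    ∑ i, ∑ j, (e'.1 i j : ℝ) * X i j = (e'.2 : ℝ)} ⟨_, rfl⟩ ?_ ?_
  · intro hS
    have key : ∀ X : Matrix (Fin 2) (Fin 2) ℝ, a * X 0 0 + b * X 0 1 = p := by
      intro X
      have hX : X ∈ (Set.univ : Set (Matrix (Fin 2) (Fin 2) ℝ)) := Set.mem_univ X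
      rw [← hS] at hX
      simpa [e, Fin.sum_univ_two] using hX
    have h0 := key !![0, 0; 0, 0]
    have h1 := key !![1, 0; 0, 0]
    have h2 := key !![0, 1; 0, 0]
    simp only [Matrix.of_apply, Matrix.cons_val', Matrix.cons_val_zero, Matrix.cons_val_one,
      Matrix.cons_val_fin_one, mul_zero, mul_one, add_zero, zero_add] at h0 h1 h2
    rcases hab with h' | h'
    · exact h' (by exact_mod_cast h1.trans h0.symm)
    · exact h' (by exact_mod_cast h2.trans h0.symm)
  · simp only [Set.mem_singleton_iff, Set.mem_ofPred_eq, forall_eq]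
    simp [e, Fin.sum_univ_two]
    linarith

/-! ### Determinant estimates and parallel integer vectors -/

theorem abs_det_two_le {a b a' b' X X' : ℝ} (ha : |a| ≤ X) (hb : |b| ≤ X) (ha' : |a'| ≤ X')
    (hb' : |b'| ≤ X') : |a * b' - b * a'| ≤ 2 * X * X' := by
  have hX : 0 ≤ X := (abs_nonneg _).trans ha
  calc |a * b' - b * a'| ≤ |a * b'| + |b * a'| := abs_sub _ _
    _ = |a| * |b'| + |b| * |a'| := by rw [abs_mul, abs_mul]
    _ ≤ X * X' + X * X' := by gcongr
    _ = 2 * X * X' := by ring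

/-- Two consecutive members of an independent sequence of integer points with small values of a
linear form whose leading coefficient is badly approximable cannot differ too much in size. -/
theorem size_le_of_badlyApproximable {α β c C ω : ℝ}
    (hα : ∀ q p : ℤ, q ≠ 0 → c ≤ |(q : ℝ)| * |α * q - p|)
    {a b p a' b' p' : ℤ} {X X' : ℝ} (hX : 0 < X) (hXX : X ≤ X')
    (ha : |(a : ℝ)| ≤ X) (hb : |(b : ℝ)| ≤ X) (ha' : |(a' : ℝ)| ≤ X') (hb' : |(b' : ℝ)| ≤ X')
    (he : |α * a + β * b - p| ≤ C * X' ^ (-ω))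
    (he' : |α * a' + β * b' - p'| ≤ |α * a + β * b - p|) :
    |α * (a * b' - b * a' : ℤ) - (p * b' - b * p' : ℤ)| ≤ 2 * C * X' ^ (1 - ω) ∧
    ((a * b' - b * a' : ℤ) ≠ 0 → c ≤ 4 * C * X * X' ^ (2 - ω)) := by
  have hX' : 0 < X' := hX.trans_le hXX
  have h1 : |α * (a * b' - b * a' : ℤ) - (p * b' - b * p' : ℤ)| ≤ 2 * C * X' ^ (1 - ω) := by
    have : α * (a * b' - b * a' : ℤ) - (p * b' - b * p' : ℤ)
        = (α * a + β * b - p) * b' - b * (α * a' + β * b' - p') := by push_cast; ring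
    rw [this]
    calc |(α * a + β * b - p) * b' - b * (α * a' + β * b' - p')|
        ≤ |(α * a + β * b - p) * b'| + |b * (α * a' + β * b' - p')| := abs_sub _ _
      _ = |α * a + β * b - p| * |(b' : ℝ)| + |(b : ℝ)| * |α * a' + β * b' - p'| := by
        rw [abs_mul, abs_mul]
      _ ≤ (C * X' ^ (-ω)) * X' + X' * (C * X' ^ (-ω)) := by
        gcongr
        · exact (abs_nonneg _).trans he
        · exact hb.trans hXX
        · exact he'.trans he
      _ = 2 * C * X' ^ (1 - ω) := by
        rw [show 1 - ω = -ω + 1 by ring, Real.rpow_add_one hX'.ne']; ring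
  refine ⟨h1, fun hne => ?_⟩
  refine (hα _ (p * b' - b * p') hne).trans ?_
  have h2 : |((a * b' - b * a' : ℤ) : ℝ)| ≤ 2 * X * X' := by
    push_cast; exact abs_det_two_le ha hb ha' hb'
  calc _ ≤ (2 * X * X') * (2 * C * X' ^ (1 - ω)) := by gcongr
    _ = 4 * C * X * X' ^ (2 - ω) := by
      rw [show 2 - ω = 1 - ω + 1 by ring, Real.rpow_add_one hX'.ne']; ring

/-- The determinant of three integer points, bounded by the values of a linear form at them. -/
theorem abs_det_three_le {α β : ℝ} {a b p a' b' p' a'' b'' p'' : ℤ} {X X' X'' L : ℝ}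
    (hXX : X ≤ X') (hXX' : X' ≤ X'')
    (ha : |(a : ℝ)| ≤ X) (hb : |(b : ℝ)| ≤ X) (ha' : |(a' : ℝ)| ≤ X') (hb' : |(b' : ℝ)| ≤ X')
    (ha'' : |(a'' : ℝ)| ≤ X'') (hb'' : |(b'' : ℝ)| ≤ X'')
    (he : |α * a + β * b - p| ≤ L) (he' : |α * a' + β * b' - p'| ≤ L)
    (he'' : |α * a'' + β * b'' - p''| ≤ L) :
    |((p * (a' * b'' - b' * a'') - p' * (a * b'' - b * a'') + p'' * (a * b' - b * a') : ℤ) : ℝ)|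
      ≤ 6 * L * X' * X'' := by
  have hX : 0 ≤ X := (abs_nonneg _).trans ha
  have hX' : 0 ≤ X' := hX.trans hXX
  have hX'' : 0 ≤ X'' := hX'.trans hXX'
  have hL : 0 ≤ L := (abs_nonneg _).trans he
  have h1 : |(a' * b'' - b' * a'' : ℝ)| ≤ 2 * X' * X'' := abs_det_two_le ha' hb' ha'' hb''
  have h2 : |(a * b'' - b * a'' : ℝ)| ≤ 2 * X' * X'' :=
    abs_det_two_le (ha.trans hXX) (hb.trans hXX) ha'' hb''
  have h3 : |(a * b' - b * a' : ℝ)| ≤ 2 * X' * X'' :=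
    abs_det_two_le (ha.trans hXX) (hb.trans hXX) (ha'.trans hXX') (hb'.trans hXX')
  -- A column operation replaces the entries `p` by the values of the form, up to sign.
  have : ((p * (a' * b'' - b' * a'') - p' * (a * b'' - b * a'') + p'' * (a * b' - b * a') : ℤ) : ℝ)
      = -((α * a + β * b - p) * (a' * b'' - b' * a'')
        - (α * a' + β * b' - p') * (a * b'' - b * a'')
        + (α * a'' + β * b'' - p'') * (a * b' - b * a')) := by push_cast; ring
  rw [this, abs_neg]
  calc _ ≤ |(α * a + β * b - p) * (a' * b'' - b' * a'')
        - (α * a' + β * b' - p') * (a * b'' - b * a'')|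
        + |(α * a'' + β * b'' - p'') * (a * b' - b * a')| := abs_add_le _ _
    _ ≤ |(α * a + β * b - p) * (a' * b'' - b' * a'')|
        + |(α * a' + β * b' - p') * (a * b'' - b * a'')|
        + |(α * a'' + β * b'' - p'') * (a * b' - b * a')| := by gcongr; exact abs_sub _ _
    _ ≤ L * (2 * X' * X'') + L * (2 * X' * X'') + L * (2 * X' * X'') := by
      simp only [abs_mul]; gcongr
    _ = 6 * L * X' * X'' := by ring

/-- Nonzero integer vectors all parallel to each other, at which an irrational linear form tends
to zero, do not exist. -/
theorem not_tendsto_zero_of_parallel {α c : ℝ} (hc : 0 < c)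
    (hα : ∀ q p : ℤ, q ≠ 0 → c ≤ |(q : ℝ)| * |α * q - p|) {u v : ℕ → ℤ}
    (hne : ∀ k, u k ≠ 0 ∨ v k ≠ 0) (hpar : ∀ k, u (k + 1) * v k = v (k + 1) * u k)
    (hlim : Filter.Tendsto (fun k => |α * u k - v k|) Filter.atTop (nhds 0)) : False := by
  have hpar0 : ∀ k, u k * v 0 = v k * u 0 := by
    intro k
    induction k with
    | zero => ring
    | succ k ih =>
      have h := hpar k
      rcases hne k with h' | h'
      · apply mul_left_cancel₀ h'
        linear_combination u (k + 1) * ih + u 0 * h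
      · apply mul_left_cancel₀ h'
        linear_combination v (k + 1) * ih + v 0 * h
  have h0 : 0 < |α * u 0 - v 0| := by
    rw [abs_pos]
    intro h
    by_cases hu : u 0 = 0
    · rcases hne 0 with h' | h'
      · exact h' hu
      · rw [hu] at h; simp at h; exact h' h
    · have := hα (u 0) (v 0) hu
      rw [h] at this; simp at this; linarith
  -- By parallelism the two values are proportional; the factor is bounded because a nonzero integer
  -- coordinate of the `k`-th vector has absolute value at least 1.
  have hbound : ∀ k, |α * u 0 - v 0| ≤ (|(u 0 : ℝ)| + |(v 0 : ℝ)|) * |α * u k - v k| := by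
    intro k
    have hp : (u k * v 0 : ℝ) = v k * u 0 := by exact_mod_cast hpar0 k
    rcases hne k with h' | h'
    · have h1 : (1 : ℝ) ≤ |(u k : ℝ)| := by exact_mod_cast Int.one_le_abs h'
      calc |α * u 0 - v 0| ≤ |(u k : ℝ)| * |α * u 0 - v 0| :=
            le_mul_of_one_le_left (abs_nonneg _) h1
        _ = |(u 0 : ℝ)| * |α * u k - v k| := by
            rw [← abs_mul, ← abs_mul]; congr 1; linear_combination -hp
        _ ≤ _ := by gcongr; exact le_add_of_nonneg_right (abs_nonneg _)
    · have h1 : (1 : ℝ) ≤ |(v k : ℝ)| := by exact_mod_cast Int.one_le_abs h'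
      calc |α * u 0 - v 0| ≤ |(v k : ℝ)| * |α * u 0 - v 0| :=
            le_mul_of_one_le_left (abs_nonneg _) h1
        _ = |(v 0 : ℝ)| * |α * u k - v k| := by
            rw [← abs_mul, ← abs_mul]; congr 1; linear_combination -α * hp
        _ ≤ _ := by gcongr; exact le_add_of_nonneg_left (abs_nonneg _)
  have := ge_of_tendsto' (hlim.const_mul (|(u 0 : ℝ)| + |(v 0 : ℝ)|)) hbound
  rw [mul_zero] at this
  linarith

/-! ### Contradiction from a sequence of minimal points -/

/-- The growth bounds rule out independent triples far along the sequence, and coplanarity then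
contradicts the irrationality of `α`. Pairwise independence (`hind`) keeps the vectors `(u k, v k)`
nonzero. -/
theorem false_of_minimal_points {α β c C ω : ℝ} (hc : 0 < c) (hC : 0 < C)
    (hα : ∀ q p : ℤ, q ≠ 0 → c ≤ |(q : ℝ)| * |α * q - p|)
    (hω : (Real.sqrt 5 + 3) / 2 < ω) {a b p : ℕ → ℤ} {X : ℕ → ℝ}
    (hX : Filter.Tendsto X Filter.atTop Filter.atTop) (hX0 : ∀ k, 1 ≤ X k)
    (hmono : ∀ k, X k ≤ X (k + 1))
    (ha : ∀ k, |(a k : ℝ)| ≤ X k) (hb : ∀ k, |(b k : ℝ)| ≤ X k)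
    (hne : ∀ k, a k ≠ 0 ∨ b k ≠ 0)
    (he : ∀ k, |α * a k + β * b k - p k| ≤ C * X (k + 1) ^ (-ω))
    (hanti : ∀ k, |α * a (k + 1) + β * b (k + 1) - p (k + 1)| ≤ |α * a k + β * b k - p k|)
    (hind : ∀ k, ∀ r s : ℤ, r * a k = s * a (k + 1) → r * b k = s * b (k + 1) →
      r * p k = s * p (k + 1) → s = 0) : False := by
  have hs5 : 2 < Real.sqrt 5 := by
    rw [Real.lt_sqrt] <;> norm_num
  have hω2 : 2 < ω := by linarith
  have hquad : 0 < (ω - 1) * (ω - 2) - 1 := by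
    have := Real.sq_sqrt (show (0 : ℝ) ≤ 5 by norm_num)
    nlinarith
  have hX1 : Filter.Tendsto (fun k => X (k + 1)) Filter.atTop Filter.atTop :=
    hX.comp (Filter.tendsto_add_atTop_nat 1)
  have hdecay : Filter.Tendsto (fun k => 2 * C * X (k + 1) ^ (1 - ω)) Filter.atTop (nhds 0) := by
    have := ((tendsto_rpow_neg_atTop (show 0 < ω - 1 by linarith)).comp hX1).const_mul (2 * C)
    simpa [Function.comp_def] using this
  set u : ℕ → ℤ := fun k => a k * b (k + 1) - b k * a (k + 1) with hu
  set v : ℕ → ℤ := fun k => p k * b (k + 1) - b k * p (k + 1) with hv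
  have hsize := fun k => size_le_of_badlyApproximable hα (zero_lt_one.trans_le (hX0 k)) (hmono k)
    (ha k) (hb k) (ha (k + 1)) (hb (k + 1)) (he k) (hanti k)
  -- If `b k = 0`, then `a k` approximates `α` better than `c` allows.
  have hb0 : ∀ᶠ k in Filter.atTop, b k ≠ 0 := by
    filter_upwards [hdecay.eventually (gt_mem_nhds hc)] with k hk hbk
    have hak : a k ≠ 0 := (hne k).resolve_right (not_not.mpr hbk)
    have h1 := hα (a k) (p k) hak
    have h2 := he k
    rw [hbk, Int.cast_zero, mul_zero, add_zero] at h2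
    have hpos : 0 < X (k + 1) := zero_lt_one.trans_le (hX0 _)
    have : |(a k : ℝ)| * |α * a k - p k| ≤ X (k + 1) * (C * X (k + 1) ^ (-ω)) := by
      gcongr
      exact (ha k).trans (hmono k)
    rw [show 1 - ω = -ω + 1 by ring, Real.rpow_add_one hpos.ne'] at hk
    have : 0 < C * (X (k + 1) ^ (-ω) * X (k + 1)) := by positivity
    linarith
  have huv : ∀ᶠ k in Filter.atTop, u k ≠ 0 ∨ v k ≠ 0 := by
    filter_upwards [hb0] with k hk
    by_contra! h
    refine hk (hind k (b (k + 1)) (b k) ?_ (mul_comm _ _) ?_)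
    · have := h.1; simp only [hu] at this; linarith
    · have := h.2; simp only [hv] at this; linarith
  have hlim : Filter.Tendsto (fun k => |α * u k - v k|) Filter.atTop (nhds 0) :=
    squeeze_zero (fun _ => abs_nonneg _) (fun k => (hsize k).1) hdecay
  have hu0 : ∀ᶠ k in Filter.atTop, u k ≠ 0 := by
    filter_upwards [huv, hlim.eventually (gt_mem_nhds zero_lt_one)] with k hk hk1 huk
    have hvk : v k ≠ 0 := hk.resolve_left (not_not.mpr huk)
    rw [huk] at hk1
    simp only [Int.cast_zero, mul_zero, zero_sub, abs_neg] at hk1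
    have : (1 : ℝ) ≤ |(v k : ℝ)| := by exact_mod_cast Int.one_le_abs hvk
    linarith
  set d : ℕ → ℤ := fun k => p k * (a (k + 1) * b (k + 2) - b (k + 1) * a (k + 2))
    - p (k + 1) * (a k * b (k + 2) - b k * a (k + 2))
    + p (k + 2) * (a k * b (k + 1) - b k * a (k + 1)) with hd
  have hd0 : ∀ᶠ k in Filter.atTop, d k = 0 := by
    -- The threshold is the constant obtained by raising `h3` to the power `ω - 2` and inserting
    -- `h4`.
    have hbig := ((tendsto_rpow_atTop hquad).comp hX1).eventually
      (Filter.eventually_gt_atTop (4 * C / c * (6 * C) ^ (ω - 2)))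
    filter_upwards [hbig, (Filter.tendsto_add_atTop_nat 1).eventually hu0] with k hk huk
    by_contra hdk
    have hp1 : 0 < X (k + 1) := zero_lt_one.trans_le (hX0 _)
    have hp2 : 0 < X (k + 2) := zero_lt_one.trans_le (hX0 _)
    have h1 : c ≤ 4 * C * X (k + 1) * X (k + 2) ^ (2 - ω) := (hsize (k + 1)).2 huk
    have h2 : (1 : ℝ) ≤ 6 * (C * X (k + 1) ^ (-ω)) * X (k + 1) * X (k + 2) := by
      have hone : (1 : ℝ) ≤ |(d k : ℝ)| := by exact_mod_cast Int.one_le_abs hdk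
      exact hone.trans (abs_det_three_le (hmono k) (hmono (k + 1)) (ha k) (hb k) (ha (k + 1))
        (hb (k + 1)) (ha (k + 2)) (hb (k + 2)) (he k) ((hanti k).trans (he k))
        (((hanti (k + 1)).trans (hanti k)).trans (he k)))
    have h3 : X (k + 1) ^ (ω - 1) ≤ 6 * C * X (k + 2) := by
      calc X (k + 1) ^ (ω - 1) ≤ X (k + 1) ^ (ω - 1) *
            (6 * (C * X (k + 1) ^ (-ω)) * X (k + 1) * X (k + 2)) :=
            le_mul_of_one_le_right (by positivity) h2
        _ = 6 * C * X (k + 2) * (X (k + 1) ^ (ω - 1) * (X (k + 1) ^ (-ω) * X (k + 1))) := by ring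
        _ = 6 * C * X (k + 2) := by
            rw [← Real.rpow_add_one hp1.ne', ← Real.rpow_add hp1,
              show ω - 1 + (-ω + 1) = 0 by ring, Real.rpow_zero, mul_one]
    have h4 : X (k + 2) ^ (ω - 2) ≤ 4 * C / c * X (k + 1) := by
      have : c * X (k + 2) ^ (ω - 2) ≤ 4 * C * X (k + 1) := by
        calc c * X (k + 2) ^ (ω - 2)
            ≤ 4 * C * X (k + 1) * X (k + 2) ^ (2 - ω) * X (k + 2) ^ (ω - 2) := by gcongr
          _ = 4 * C * X (k + 1) := by
            rw [mul_assoc, ← Real.rpow_add hp2, show 2 - ω + (ω - 2) = 0 by ring,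
              Real.rpow_zero, mul_one]
      rw [div_mul_eq_mul_div, le_div_iff₀ hc]
      linarith
    have h5 : X (k + 1) ^ ((ω - 1) * (ω - 2)) ≤ (6 * C) ^ (ω - 2) * (4 * C / c * X (k + 1)) := by
      calc X (k + 1) ^ ((ω - 1) * (ω - 2)) = (X (k + 1) ^ (ω - 1)) ^ (ω - 2) :=
            Real.rpow_mul hp1.le _ _
        _ ≤ (6 * C * X (k + 2)) ^ (ω - 2) :=
            Real.rpow_le_rpow (by positivity) h3 (by linarith)
        _ = (6 * C) ^ (ω - 2) * X (k + 2) ^ (ω - 2) := Real.mul_rpow (by positivity) hp2.le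
        _ ≤ _ := by gcongr
    simp only [Function.comp_apply] at hk
    have h6 : X (k + 1) ^ ((ω - 1) * (ω - 2))
        = X (k + 1) ^ ((ω - 1) * (ω - 2) - 1) * X (k + 1) := by
      rw [← Real.rpow_add_one hp1.ne']; congr 1; ring
    rw [h6] at h5
    have := mul_lt_mul_of_pos_right hk hp1
    linarith
  obtain ⟨K, hK⟩ := Filter.eventually_atTop.mp (huv.and hd0)
  refine not_tendsto_zero_of_parallel hc hα (u := fun k => u (k + K)) (v := fun k => v (k + K))
    (fun k => (hK _ (Nat.le_add_left _ _)).1) (fun k => ?_)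
    (hlim.comp (Filter.tendsto_add_atTop_nat K))
  have := (hK (k + K) (Nat.le_add_left _ _)).2
  simp only [hd] at this
  simp only [hu, hv, show k + 1 + K = k + K + 1 by ring, add_assoc, one_add_one_eq_two]
  simp only [add_assoc] at this
  -- With shifted indices, `u (k+1) * v k - v (k+1) * u k = b (k+1) * d k`.
  linear_combination b (k + (K + 1)) * this

/-! ### Construction of the minimal points -/

/-- A linear form `α x + β y - z` without integer zeros, and with `α` badly approximable, is not
uniformly small at integer points to an order beyond `(√5 + 3) / 2`. -/
theorem not_eventually_exists_small {α β c C ω : ℝ} (hc : 0 < c) (hC : 0 < C)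
    (hα : ∀ q p : ℤ, q ≠ 0 → c ≤ |(q : ℝ)| * |α * q - p|)
    (hω : (Real.sqrt 5 + 3) / 2 < ω)
    (hirr : ∀ a b p : ℤ, (a ≠ 0 ∨ b ≠ 0) → α * a + β * b - p ≠ 0)
    (h : ∀ᶠ t : ℝ in Filter.atTop, ∃ a b p : ℤ, (a ≠ 0 ∨ b ≠ 0) ∧ |(a : ℝ)| ≤ t ∧ |(b : ℝ)| ≤ t ∧
      |α * a + β * b - p| ≤ C * t ^ (-ω)) : False := by
  have hω0 : 0 < ω := by have := Real.sqrt_nonneg 5; linarith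
  let g : ℤ × ℤ → ℝ := fun q => |α * q.1 + β * q.2 - round (α * q.1 + β * q.2)|
  let S : ℕ → Set (ℤ × ℤ) := fun N =>
    {q | (q.1 ≠ 0 ∨ q.2 ≠ 0) ∧ |q.1| ≤ N ∧ |q.2| ≤ N}
  have hSfin : ∀ N, (S N).Finite := fun N => by
    refine (Set.finite_Icc ((-N, -N) : ℤ × ℤ) ((N, N) : ℤ × ℤ)).subset ?_
    rintro ⟨x, y⟩ ⟨-, h1, h2⟩
    rw [abs_le] at h1 h2
    exact ⟨⟨h1.1, h2.1⟩, ⟨h1.2, h2.2⟩⟩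
  have hgpos : ∀ q : ℤ × ℤ, (q.1 ≠ 0 ∨ q.2 ≠ 0) → 0 < g q := fun q hq =>
    abs_pos.mpr (hirr _ _ _ hq)
  have hmin : ∀ N : ℕ, ∃ q, 1 ≤ N → q ∈ S N ∧ ∀ q' ∈ S N, g q ≤ g q' := by
    intro N
    by_cases hN : 1 ≤ N
    · obtain ⟨q, hq⟩ := Set.exists_min_image (S N) g (hSfin N)
        ⟨(1, 0), Or.inl one_ne_zero, by simpa using hN, by simp⟩
      exact ⟨q, fun _ => hq⟩
    · exact ⟨0, fun h' => absurd h' hN⟩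
  choose m hm using hmin
  have hsmall : ∀ᶠ N : ℕ in Filter.atTop, g (m N) ≤ C * (N : ℝ) ^ (-ω) := by
    filter_upwards [tendsto_natCast_atTop_atTop.eventually h, Filter.eventually_ge_atTop 1]
      with N hN hN1
    obtain ⟨a, b, p, hab, ha, hb, he⟩ := hN
    refine ((hm N hN1).2 (a, b) ⟨hab, ?_, ?_⟩).trans ((round_le _ p).trans he)
    · exact_mod_cast ha
    · exact_mod_cast hb
  obtain ⟨N₀, hN₀⟩ := Filter.eventually_atTop.mp hsmall
  have hlim : Filter.Tendsto (fun N : ℕ => C * (N : ℝ) ^ (-ω)) Filter.atTop (nhds 0) := by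
    simpa using ((tendsto_rpow_neg_atTop hω0).comp tendsto_natCast_atTop_atTop).const_mul C
  -- `N'` is the first box size at which the minimum drops. The bound at `N' - 1` still controls the
  -- old minimum, and `N' - 1 ≥ N' / 2` costs the factor `2 ^ ω`. Starting at `N₀ + 1` keeps the
  -- boxes nonempty.
  have hnext : ∀ N : ℕ, ∃ N' : ℕ, N₀ + 1 ≤ N → N < N' ∧ g (m N') < g (m N) ∧
      g (m N) ≤ C * 2 ^ ω * (N' : ℝ) ^ (-ω) := by
    intro N
    by_cases hN : N₀ + 1 ≤ N
    swap
    · exact ⟨0, fun h' => absurd h' hN⟩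
    have hmN := hm N (by omega)
    have hex : ∃ N', N < N' ∧ g (m N') < g (m N) := by
      obtain ⟨N', h1, h2, h3⟩ := ((hlim.eventually (gt_mem_nhds (hgpos _ hmN.1.1))).and
        ((Filter.eventually_gt_atTop N).and (Filter.eventually_ge_atTop N₀))).exists
      exact ⟨N', h2, (hN₀ N' h3).trans_lt h1⟩
    classical
    refine ⟨Nat.find hex, fun _ => ⟨(Nat.find_spec hex).1, (Nat.find_spec hex).2, ?_⟩⟩
    set N' := Nat.find hex with hN'
    have hlt : N < N' := (Nat.find_spec hex).1
    have hprev : g (m N) ≤ g (m (N' - 1)) := by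
      rcases Nat.lt_or_ge N (N' - 1) with h' | h'
      · have := Nat.find_min hex (show N' - 1 < N' by omega)
        push Not at this
        exact this h'
      · rw [show N' - 1 = N by omega]
    refine (hprev.trans (hN₀ (N' - 1) (by omega))).trans ?_
    rw [mul_assoc]
    refine mul_le_mul_of_nonneg_left ?_ hC.le
    have h2N : (2 : ℝ) ≤ N' := by exact_mod_cast (show 2 ≤ N' by omega)
    have hcast : ((N' - 1 : ℕ) : ℝ) = N' - 1 := by
      rw [Nat.cast_sub (by omega)]; simp
    calc ((N' - 1 : ℕ) : ℝ) ^ (-ω) ≤ ((N' : ℝ) / 2) ^ (-ω) := by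
          refine Real.rpow_le_rpow_of_nonpos (by linarith) ?_ (by linarith)
          rw [hcast]; linarith
      _ = 2 ^ ω * (N' : ℝ) ^ (-ω) := by
          rw [Real.div_rpow (by linarith) (by norm_num), Real.rpow_neg (by norm_num : (0 : ℝ) ≤ 2)]
          rw [div_inv_eq_mul, mul_comm]
  choose next hnext using hnext
  let N : ℕ → ℕ := fun k => next^[k] (N₀ + 1)
  have hNsucc : ∀ k, N (k + 1) = next (N k) := fun k => Function.iterate_succ_apply' _ _ _
  have hNge : ∀ k, N₀ + 1 ≤ N k := by
    intro k
    induction k with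
    | zero => exact le_rfl
    | succ k ih => rw [hNsucc]; exact ih.trans (hnext _ ih).1.le
  have hN : ∀ k, N k < N (k + 1) ∧ g (m (N (k + 1))) < g (m (N k)) ∧
      g (m (N k)) ≤ C * 2 ^ ω * (N (k + 1) : ℝ) ^ (-ω) := fun k => by
    rw [hNsucc]; exact hnext _ (hNge k)
  have hmN := fun k => hm (N k) (by have := hNge k; omega)
  refine false_of_minimal_points (β := β) (C := C * 2 ^ ω) hc (by positivity) hα hω
    (a := fun k => (m (N k)).1) (b := fun k => (m (N k)).2)
    (p := fun k => round (α * (m (N k)).1 + β * (m (N k)).2)) (X := fun k => (N k : ℝ))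
    (tendsto_natCast_atTop_atTop.comp (strictMono_nat_of_lt_succ fun k => (hN k).1).tendsto_atTop)
    (fun k => ?_) (fun k => ?_) (fun k => ?_) (fun k => ?_) (fun k => (hmN k).1.1)
    (fun k => (hN k).2.2) (fun k => (hN k).2.1.le) ?_
  · exact_mod_cast (show 1 ≤ N k by have := hNge k; omega)
  · exact_mod_cast (hN k).1.le
  · exact_mod_cast (hmN k).1.2.1
  · exact_mod_cast (hmN k).1.2.2
  · intro k r s h1 h2 h3
    -- If `P_k` and `P_{k+1}` were proportional, the smaller value at `P_{k+1}` would make it no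
    -- larger than `P_k`, so it would lie in the box where `P_k` is minimal.
    by_contra hs
    have hlt := (hN k).2.1
    have hval : |(r : ℝ)| * g (m (N k)) = |(s : ℝ)| * g (m (N (k + 1))) := by
      simp only [g]
      rw [← abs_mul, ← abs_mul]
      congr 1
      have h1' : (r * (m (N k)).1 : ℝ) = s * (m (N (k + 1))).1 := by exact_mod_cast h1
      have h2' : (r * (m (N k)).2 : ℝ) = s * (m (N (k + 1))).2 := by exact_mod_cast h2
      have h3' : (r * round (α * (m (N k)).1 + β * (m (N k)).2) : ℝ)
          = s * round (α * (m (N (k + 1))).1 + β * (m (N (k + 1))).2) := by exact_mod_cast h3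
      linear_combination α * h1' + β * h2' - h3'
    have hs' : 0 < |(s : ℝ)| := abs_pos.mpr (by exact_mod_cast hs)
    have hrs : |r| ≤ |s| := by
      by_contra! hsr
      have hsr' : |(s : ℝ)| < |(r : ℝ)| := by exact_mod_cast hsr
      have := mul_lt_mul'' hsr' hlt (abs_nonneg _) (abs_nonneg _)
      linarith
    have hle : ∀ x y : ℤ, r * x = s * y → |y| ≤ |x| := by
      intro x y hxy
      have h' : |r| * |x| = |s| * |y| := by rw [← abs_mul, ← abs_mul, hxy]
      refine le_of_mul_le_mul_left (a := |s|) ?_ (abs_pos.mpr hs)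
      rw [← h']
      exact mul_le_mul_of_nonneg_right hrs (abs_nonneg _)
    refine absurd ((hmN k).2 (m (N (k + 1))) ⟨(hmN (k + 1)).1.1, ?_, ?_⟩) (not_le.mpr hlt)
    · exact (hle _ _ h1).trans (hmN k).1.2.1
    · exact (hle _ _ h2).trans (hmN k).1.2.2

/-! ### From matrices to the first-row form -/

/-- The sup norm dominates the first coordinate, so uniform approximability passes to the first row.
Both claims of the main theorem follow: the exponent bound by taking `f` to be `powerDecay a`. -/
theorem not_isUniformlyApproximable {α : ℝ} (hα : IsBadlyApproximable α) {f : ℝ → ℝ} {ω : ℝ}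
    (hω : (Real.sqrt 5 + 3) / 2 < ω)
    (hf : Asymptotics.IsBigO Filter.atTop f (powerDecay ω))
    {A : Matrix (Fin 2) (Fin 2) ℝ} (hAα : A ∈ topLeftSubspace α) (hA : IsTotallyIrrational A) :
    ¬ IsUniformlyApproximable f A := by
  intro hunif
  obtain ⟨c, hc, hα⟩ := hα.exists_pos_le
  obtain ⟨C, hC, hfC⟩ := hf.exists_pos
  obtain rfl : A 0 0 = α := hAα
  refine not_eventually_exists_small hc hC hα hω hA.row_ne_zero ?_
  filter_upwards [hunif, hfC.bound, Filter.eventually_ge_atTop 0] with t ht hft ht0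
  obtain ⟨q, hq, p, hqp, hqt⟩ := ht
  have hqi : ∀ i, |(q i : ℝ)| ≤ t := fun i => by
    have := (norm_le_pi_norm q i).trans hqt
    rwa [Int.norm_eq_abs] at this
  refine ⟨q 0, q 1, p 0, ?_, hqi 0, hqi 1, ?_⟩
  · by_contra! h
    exact hq (funext fun i => by fin_cases i <;> simp [h.1, h.2])
  · have h0 := (norm_le_pi_norm _ (0 : Fin 2)).trans hqp
    simp only [Matrix.mulVec, dotProduct, Fin.sum_univ_two, Pi.sub_apply, Real.norm_eq_abs] at h0
    refine h0.trans ((le_abs_self _).trans (hft.trans_eq ?_))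
    rw [powerDecay, Real.norm_of_nonneg (Real.rpow_nonneg ht0 _)]

theorem proposition4p1 (α : ℝ) (hα : IsBadlyApproximable α) :
    (∀ A ∈ topLeftSubspace α, IsTotallyIrrational A →
      uniformExponent A ≤ (((Real.sqrt 5 + 3) / 2 : ℝ) : EReal)) ∧
    (∀ f : ℝ → ℝ, (∀ t : ℝ, 0 < t → 0 < f t) →
      (∃ ε : ℝ, 0 < ε ∧
        Asymptotics.IsBigO Filter.atTop f (powerDecay ((Real.sqrt 5 + 3) / 2 + ε))) →
      ∀ A ∈ topLeftSubspace α, IsTotallyIrrational A → ¬ IsUniformlyApproximable f A) := by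
  refine ⟨fun A hAα hA => sSup_le ?_, ?_⟩
  · rintro _ ⟨a, ⟨-, ha⟩, rfl⟩
    rw [EReal.coe_le_coe_iff]
    by_contra! h
    exact not_isUniformlyApproximable hα h (Asymptotics.isBigO_refl _ _) hAα hA ha
  · rintro f - ⟨ε, hε, hf⟩ A hAα hA
    exact not_isUniformlyApproximable hα (by linarith) hf hAα hA
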